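/- Let $n\in\mathbb N$. Let $\operatorname{Tam}_n$ be the set of planar binary trees with $n$ (internal) vertices, with the Tamari order: the reflexive transitive closure of the rotations replacing a subtree $((A,B),C)$ by $(A,(B,C))$. Label the vertices of a binary tree $T$ by $1,\dots,n$ in in-order, and write $i\lhd_T j$ if the vertex $i$ belongs to the subtree with root $j$. The interval-poset of an interval $[S,T]$ of $\operatorname{Tam}_n$ is the partial order $\lhd$ on $\{1,\dots,n\}$ given, for $a<b$, by $b\lhd a\Leftrightarrow b\lhd_S a$ and $a\lhd b\Leftrightarrow a\lhd_T b$. An interval-poset is called exceptional if its Hasse diagram (with an arrow $i\to j$ when $j$ covers $i$ for $\lhd$) contains no configuration $y\to z$, $y\to x$ with $x<y<z$. Let $\mathrm{NC}_n$ be the set of noncrossing partitions of $\{1,\dots,n\}$, ordered by refinement ($\pi_1\leqslant\pi_2$ if every block of $\pi_1$ is contained in a block of $\pi_2$). For $\pi\in\mathrm{NC}_n$ let $T_\pi\in\operatorname{Tam}_n$ be the binary tree with vertices $1,\dots,n$ in which $y$ is the right son of $x$ if $y$ is the successor of $x$ in its block, $y$ is the left son of $x$ if $y$ is the least element of the block whose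 greatest element is $x-1$, and (for $n\geqslant 1$) the root is the least element of the block of $n$. **Theorem.** Let $I$ be an interval of $\operatorname{Tam}_n$. Then there is an interval $[\pi_1,\pi_2]$ of $\mathrm{NC}_n$ (with $\pi_1\leqslant\pi_2$) such that $I=[T_{\pi_1},T_{\pi_2}]$ if and only if the interval-poset of $I$ is exceptional. -/

import Mathlib

namespace Tamari

open BinaryTree

/-! ### Binary trees and the Tamari order -/

/-- Elementary right rotation somewhere in a tree: a subtree `(A, B), C` is replaced by
`A, (B, C)`. -/
inductive Rotation : BinaryTree Unit → BinaryTree Unit → Prop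
  | root (a b c : BinaryTree Unit) :
      Rotation (node () (node () a b) c) (node () a (node () b c))
  | left {a a' : BinaryTree Unit} (b : BinaryTree Unit) (h : Rotation a a') :
      Rotation (node () a b) (node () a' b)
  | right (a : BinaryTree Unit) {b b' : BinaryTree Unit} (h : Rotation b b') :
      Rotation (node () a b) (node () a b')

/-- Sum over all vertices of the size of the right subtree; it strictly increases under
rotations, which shows that the Tamari order is antisymmetric. -/
def weight : BinaryTree Unit → ℕ
  | nil => 0
  | node _ l r => weight l + weight r + r.numNodes

theorem Rotation.numNodes_eq {s t : BinaryTree Unit} (h : Rotation s t) :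
    s.numNodes = t.numNodes := by
  induction h <;> simp only [numNodes] <;> omega

theorem Rotation.weight_lt {s t : BinaryTree Unit} (h : Rotation s t) :
    weight s < weight t := by
  induction h with
  | root a b c => simp only [weight, numNodes]; omega
  | left b h ih => simp only [weight]; omega
  | right a h ih => have := h.numNodes_eq; simp only [weight]; omega

/-- Planar binary trees with `n` (internal) vertices. -/
def Tam (n : ℕ) : Type := {t : BinaryTree Unit // t.numNodes = n}

theorem weight_le_of_reflTransGen {s t : BinaryTree Unit}
    (h : Relation.ReflTransGen Rotation s t) : s = t ∨ weight s < weight t := by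
  induction h with
  | refl => exact Or.inl rfl
  | tail _ h2 ih =>
    right
    rcases ih with rfl | ih
    · exact h2.weight_lt
    · exact ih.trans h2.weight_lt

/-- The Tamari order: the reflexive transitive closure of right rotation. -/
instance (n : ℕ) : PartialOrder (Tam n) where
  le s t := Relation.ReflTransGen Rotation s.1 t.1
  le_refl _ := Relation.ReflTransGen.refl
  le_trans _ _ _ h1 h2 := Relation.ReflTransGen.trans h1 h2
  le_antisymm s t h1 h2 := by
    apply Subtype.ext
    rcases weight_le_of_reflTransGen h1 with h | h
    · exact h
    · rcases weight_le_of_reflTransGen h2 with h' | h'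
      · exact h'.symm
      · omega

/-! ### The order induced by a tree on its vertices -/

/-- Label the vertices of `t` in in-order by `k, k + 1, …, k + t.numNodes - 1`. Then
`Below t k i j` says that the vertex labelled `i` belongs to the subtree whose root is the
vertex labelled `j`. -/
def Below : BinaryTree Unit → ℕ → ℕ → ℕ → Prop
  | nil, _, _, _ => False
  | node _ l r, k, i, j =>
      (j = k + l.numNodes ∧ k ≤ i ∧ i < k + l.numNodes + r.numNodes + 1) ∨
        Below l k i j ∨ Below r (k + l.numNodes + 1) i j

theorem Below.bounds {t : BinaryTree Unit} : ∀ {k i j : ℕ}, Below t k i j →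
    k ≤ i ∧ i < k + t.numNodes ∧ k ≤ j ∧ j < k + t.numNodes := by
  induction t with
  | nil => intro k i j h; exact h.elim
  | node v l r hl hr =>
    intro k i j h
    simp only [numNodes]
    rcases h with h | h | h
    · omega
    · have := hl h; omega
    · have := hr h; omega

theorem Below.refl {t : BinaryTree Unit} : ∀ {k i : ℕ}, k ≤ i → i < k + t.numNodes →
    Below t k i i := by
  induction t with
  | nil => intro k i h h'; simp only [numNodes] at h'; omega
  | node v l r hl hr =>
    intro k i h h'
    simp only [numNodes] at h'
    rcases lt_trichotomy i (k + l.numNodes) with h1 | h1 | h1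
    · exact Or.inr (Or.inl (hl h h1))
    · exact Or.inl ⟨h1, by omega, by omega⟩
    · exact Or.inr (Or.inr (hr (by omega) (by omega)))

theorem Below.trans {t : BinaryTree Unit} : ∀ {k i j m : ℕ}, Below t k i j → Below t k j m →
    Below t k i m := by
  induction t with
  | nil => intro k i j m h; exact h.elim
  | node v l r hl hr =>
    intro k i j m h h'
    have hb := h.bounds
    simp only [numNodes] at hb
    rcases h' with h' | h' | h'
    · exact Or.inl ⟨h'.1, by omega, by omega⟩
    · have hb' := h'.bounds
      rcases h with h | h | h
      · omega
      · exact Or.inr (Or.inl (hl h h'))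
      · have := h.bounds; omega
    · have hb' := h'.bounds
      rcases h with h | h | h
      · omega
      · have := h.bounds; omega
      · exact Or.inr (Or.inr (hr h h'))

theorem Below.antisymm {t : BinaryTree Unit} : ∀ {k i j : ℕ}, Below t k i j → Below t k j i →
    i = j := by
  induction t with
  | nil => intro k i j h; exact h.elim
  | node v l r hl hr =>
    intro k i j h h'
    rcases h with h | h | h <;> rcases h' with h' | h' | h'
    · omega
    · have := h'.bounds; omega
    · have := h'.bounds; omega
    · have := h.bounds; omega
    · exact hl h h'
    · have := h.bounds; have := h'.bounds; omega
    · have := h.bounds; omega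
    · have := h.bounds; have := h'.bounds; omega
    · exact hr h h'

theorem Below.between {t : BinaryTree Unit} : ∀ {k i j m : ℕ}, Below t k i j →
    min i j ≤ m → m ≤ max i j → Below t k m j := by
  induction t with
  | nil => intro k i j m h; exact h.elim
  | node v l r hl hr =>
    intro k i j m h h1 h2
    rcases h with h | h | h
    · exact Or.inl ⟨h.1, by omega, by omega⟩
    · exact Or.inr (Or.inl (hl h h1 h2))
    · exact Or.inr (Or.inr (hr h h1 h2))

theorem Rotation.below_dec {s t : BinaryTree Unit} (h : Rotation s t) :
    ∀ {k i j : ℕ}, j < i → Below s k i j → Below t k i j := by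
  induction h with
  | root a b c =>
    intro k i j hij h
    simp only [Below, numNodes] at h ⊢
    rcases h with h | (h | h | h) | h
    · refine Or.inr (Or.inr (Or.inl ?_)); omega
    · refine Or.inl ?_; omega
    · exact Or.inr (Or.inl h)
    · exact Or.inr (Or.inr (Or.inr (Or.inl h)))
    · refine Or.inr (Or.inr (Or.inr (Or.inr ?_)))
      convert h using 1; omega
  | left b h ih =>
    intro k i j hij hB
    simp only [Below, h.numNodes_eq] at hB ⊢
    exact hB.imp_right (Or.imp_left (ih hij))
  | right a h ih =>
    intro k i j hij hB
    simp only [Below, h.numNodes_eq] at hB ⊢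
    exact hB.imp_right (Or.imp_right (ih hij))

theorem Rotation.below_inc {s t : BinaryTree Unit} (h : Rotation s t) :
    ∀ {k i j : ℕ}, i < j → Below t k i j → Below s k i j := by
  induction h with
  | root a b c =>
    intro k i j hij h
    simp only [Below, numNodes] at h ⊢
    rcases h with h | h | h | h | h
    · refine Or.inr (Or.inl (Or.inl ?_)); omega
    · exact Or.inr (Or.inl (Or.inr (Or.inl h)))
    · refine Or.inl ?_; omega
    · exact Or.inr (Or.inl (Or.inr (Or.inr h)))
    · refine Or.inr (Or.inr ?_)
      convert h using 1; omega
  | left b h ih =>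
    intro k i j hij hB
    simp only [Below, h.numNodes_eq] at hB ⊢
    exact hB.imp_right (Or.imp_left (ih hij))
  | right a h ih =>
    intro k i j hij hB
    simp only [Below, h.numNodes_eq] at hB ⊢
    exact hB.imp_right (Or.imp_right (ih hij))

/-- The relation `i ⊲ j` induced by a tree on its vertices, which are labelled in in-order by
`Fin n` (that is, by `0, …, n - 1`). -/
def Tam.rel {n : ℕ} (t : Tam n) (i j : Fin n) : Prop := Below t.1 0 i j

theorem Tam.rel_dec_of_le {n : ℕ} {s t : Tam n} (h : s ≤ t) {i j : Fin n} (hij : j < i)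
    (hs : s.rel i j) : t.rel i j := by
  have key : ∀ {u v : BinaryTree Unit}, Relation.ReflTransGen Rotation u v →
      Below u 0 i j → Below v 0 i j := by
    intro u v huv hu
    induction huv with
    | refl => exact hu
    | tail _ h2 ih => exact h2.below_dec hij ih
  exact key h hs

theorem Tam.rel_inc_of_le {n : ℕ} {s t : Tam n} (h : s ≤ t) {i j : Fin n} (hij : i < j)
    (ht : t.rel i j) : s.rel i j := by
  have key : ∀ {u v : BinaryTree Unit}, Relation.ReflTransGen Rotation u v →
      Below v 0 i j → Below u 0 i j := by
    intro u v huv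
    induction huv with
    | refl => exact id
    | tail _ h2 ih => exact fun hv => ih (h2.below_inc hij hv)
  exact key h ht

theorem Tam.rel_refl {n : ℕ} (t : Tam n) (i : Fin n) : t.rel i i :=
  Below.refl (Nat.zero_le _) (by rw [t.2]; omega)

/-! ### Interval-posets -/

/-- An interval-poset of size `n`: a partial order `⊲` on `Fin n` (with its usual order `<`)
satisfying the two interval-poset conditions. -/
structure IntervalPoset (n : ℕ) where
  rel : Fin n → Fin n → Prop
  refl : ∀ a, rel a a
  antisymm : ∀ a b, rel a b → rel b a → a = b
  trans : ∀ a b c, rel a b → rel b c → rel a c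
  inc : ∀ a b c, a < b → b < c → rel a c → rel b c
  dec : ∀ a b c, a < b → b < c → rel c a → rel b a

/-- There is an arrow `y → z` in the Hasse diagram: `z` covers `y` for `⊲`. -/
def IntervalPoset.Arrow {n : ℕ} (P : IntervalPoset n) (y z : Fin n) : Prop :=
  P.rel y z ∧ y ≠ z ∧ ∀ w, P.rel y w → P.rel w z → w = y ∨ w = z

/-- An interval-poset is exceptional if its Hasse diagram contains no `y → z`, `y → x` with
`x < y < z`. -/
def IntervalPoset.IsExceptional {n : ℕ} (P : IntervalPoset n) : Prop :=
  ¬ ∃ x y z : Fin n, x < y ∧ y < z ∧ P.Arrow y z ∧ P.Arrow y x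

/-- The relation of the interval-poset of `[S, T]`: the decreasing relations of `S` together
with the increasing relations of `T` (and the trivial relations). -/
def intervalRel {n : ℕ} (S T : Tam n) (i j : Fin n) : Prop :=
  i = j ∨ (j < i ∧ S.rel i j) ∨ (i < j ∧ T.rel i j)

theorem intervalRel_iff {n : ℕ} {S T : Tam n} (h : S ≤ T) (i j : Fin n) :
    intervalRel S T i j ↔ S.rel i j ∧ T.rel i j := by
  constructor
  · rintro (rfl | ⟨hij, hs⟩ | ⟨hij, ht⟩)
    · exact ⟨S.rel_refl i, T.rel_refl i⟩
    · exact ⟨hs, Tam.rel_dec_of_le h hij hs⟩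
    · exact ⟨Tam.rel_inc_of_le h hij ht, ht⟩
  · rintro ⟨hs, ht⟩
    rcases lt_trichotomy i j with hij | hij | hij
    · exact Or.inr (Or.inr ⟨hij, ht⟩)
    · exact Or.inl hij
    · exact Or.inr (Or.inl ⟨hij, hs⟩)

/-- The interval-poset corresponding to an interval of the Tamari lattice. -/
def intervalPoset {n : ℕ} (I : NonemptyInterval (Tam n)) : IntervalPoset n where
  rel := intervalRel I.fst I.snd
  refl _ := Or.inl rfl
  antisymm a b h1 h2 := by
    rw [intervalRel_iff I.fst_le_snd] at h1 h2
    exact Fin.ext (Below.antisymm h1.1 h2.1)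
  trans a b c h1 h2 := by
    rw [intervalRel_iff I.fst_le_snd] at h1 h2 ⊢
    exact ⟨Below.trans h1.1 h2.1, Below.trans h1.2 h2.2⟩
  inc a b c hab hbc h := by
    have h1 : (a : ℕ) < b := hab
    have h2 : (b : ℕ) < c := hbc
    rw [intervalRel_iff I.fst_le_snd] at h ⊢
    exact ⟨Below.between h.1 (by omega) (by omega), Below.between h.2 (by omega) (by omega)⟩
  dec a b c hab hbc h := by
    have h1 : (a : ℕ) < b := hab
    have h2 : (b : ℕ) < c := hbc
    rw [intervalRel_iff I.fst_le_snd] at h ⊢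
    exact ⟨Below.between h.1 (by omega) (by omega), Below.between h.2 (by omega) (by omega)⟩

/-! ### Noncrossing partitions and their trees -/

/-- A partition of `Fin n` is noncrossing if there are no `i < j < k < l` with `i, k` in one
block and `j, l` in a different block. -/
def IsNoncrossing {n : ℕ} (π : Finpartition (Finset.univ : Finset (Fin n))) : Prop :=
  ¬ ∃ b ∈ π.parts, ∃ c ∈ π.parts, b ≠ c ∧
    ∃ i j k l : Fin n, i < j ∧ j < k ∧ k < l ∧ i ∈ b ∧ k ∈ b ∧ j ∈ c ∧ l ∈ c

/-- Noncrossing partitions of `Fin n`, ordered by refinement (`π₁ ≤ π₂` if every block of `π₁`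
is contained in a block of `π₂`, the order of `Finpartition`). -/
abbrev NC (n : ℕ) : Type :=
  {π : Finpartition (Finset.univ : Finset (Fin n)) // IsNoncrossing π}

/-- `y` is the right son of `x`: it is the successor of `x` in its block. -/
def IsRightSon {n : ℕ} (π : Finpartition (Finset.univ : Finset (Fin n))) (x y : Fin n) : Prop :=
  ∃ b ∈ π.parts, x ∈ b ∧ y ∈ b ∧ x < y ∧ ∀ z ∈ b, x < z → y ≤ z

/-- `y` is the left son of `x`: it is the least element of a block whose greatest element `m`
satisfies `m + 1 = x`. For `x = n` this says that `y` is the least element of the block of the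
last element `n - 1`, i.e. that `y` is the root of the whole tree. -/
def IsLeftSon {n : ℕ} (π : Finpartition (Finset.univ : Finset (Fin n))) (x : ℕ) (y : Fin n) :
    Prop :=
  ∃ b ∈ π.parts, IsLeast (b : Set (Fin n)) y ∧
    ∃ m : Fin n, IsGreatest (b : Set (Fin n)) m ∧ (m : ℕ) + 1 = x

open Classical in
/-- The first `k` levels of the labelled binary tree whose root is the vertex satisfying `p`
(empty if there is none), and whose left and right sons are given by `IsLeftSon` and
`IsRightSon`. -/
noncomputable def grow {n : ℕ} (π : Finpartition (Finset.univ : Finset (Fin n))) :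
    ℕ → (Fin n → Prop) → BinaryTree (Fin n)
  | 0, _ => nil
  | k + 1, p =>
    if h : ∃ y, p y then
      node h.choose (grow π k (IsLeftSon π (h.choose : ℕ))) (grow π k (IsRightSon π h.choose))
    else nil

/-- The labelled binary tree of `π` (it has `n` vertices, hence at most `n` levels). -/
noncomputable def labelledTree {n : ℕ} (π : Finpartition (Finset.univ : Finset (Fin n))) :
    BinaryTree (Fin n) :=
  grow π n (IsLeftSon π n)

/-- The list of labels in in-order. -/
def inorder {α : Type*} : BinaryTree α → List α
  | nil => []
  | node x l r => inorder l ++ x :: inorder r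

theorem length_inorder {α : Type*} (t : BinaryTree α) : (inorder t).length = t.numNodes := by
  induction t with
  | nil => rfl
  | node x l r hl hr => simp only [inorder, List.length_append, List.length_cons, numNodes]; omega

theorem numNodes_map {α β : Type*} (f : α → β) (t : BinaryTree α) :
    (t.map f).numNodes = t.numNodes := by
  induction t with
  | nil => rfl
  | node x l r hl hr => simp only [BinaryTree.map, numNodes, hl, hr]

/-- Two elements are in the same block. -/
def SameBlock {n : ℕ} (π : Finpartition (Finset.univ : Finset (Fin n))) (x y : Fin n) : Prop :=
  ∃ b ∈ π.parts, x ∈ b ∧ y ∈ b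

section

variable {n : ℕ} {π : Finpartition (Finset.univ : Finset (Fin n))}

theorem SameBlock.refl (x : Fin n) : SameBlock π x x := by
  obtain ⟨b, hb, hx⟩ := π.exists_mem (Finset.mem_univ x)
  exact ⟨b, hb, hx, hx⟩

theorem SameBlock.symm {x y : Fin n} (h : SameBlock π x y) : SameBlock π y x := by
  obtain ⟨b, hb, hx, hy⟩ := h
  exact ⟨b, hb, hy, hx⟩

theorem SameBlock.trans {x y z : Fin n} (h : SameBlock π x y) (h' : SameBlock π y z) :
    SameBlock π x z := by
  obtain ⟨b, hb, hx, hy⟩ := h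
  obtain ⟨c, hc, hy', hz⟩ := h'
  obtain rfl := π.eq_of_mem_parts hb hc hy hy'
  exact ⟨b, hb, hx, hz⟩

theorem mem_iff_sameBlock {x y : Fin n} {b : Finset (Fin n)} (hb : b ∈ π.parts) (hx : x ∈ b) :
    y ∈ b ↔ SameBlock π x y := by
  constructor
  · intro hy
    exact ⟨b, hb, hx, hy⟩
  · rintro ⟨c, hc, hx', hy⟩
    obtain rfl := π.eq_of_mem_parts hb hc hx hx'
    exact hy

theorem IsNoncrossing.sameBlock (hπ : IsNoncrossing π) {i j k l : Fin n} (hij : i < j)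
    (hjk : j < k) (hkl : k < l) (hik : SameBlock π i k) (hjl : SameBlock π j l) :
    SameBlock π i j := by
  obtain ⟨b, hb, hi, hk⟩ := hik
  obtain ⟨c, hc, hj, hl⟩ := hjl
  by_cases hbc : b = c
  · subst hbc
    exact ⟨b, hb, hi, hj⟩
  · exact (hπ ⟨b, hb, c, hc, hbc, i, j, k, l, hij, hjk, hkl, hi, hk, hj, hl⟩).elim

theorem isRightSon_iff {x y : Fin n} :
    IsRightSon π x y ↔ SameBlock π x y ∧ x < y ∧ ∀ z, SameBlock π x z → x < z → y ≤ z := by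
  constructor
  · rintro ⟨b, hb, hx, hy, hxy, h⟩
    exact ⟨⟨b, hb, hx, hy⟩, hxy, fun z hz => h z ((mem_iff_sameBlock hb hx).2 hz)⟩
  · rintro ⟨⟨b, hb, hx, hy⟩, hxy, h⟩
    exact ⟨b, hb, hx, hy, hxy, fun z hz => h z ((mem_iff_sameBlock hb hx).1 hz)⟩

theorem isLeftSon_iff {x : ℕ} {y : Fin n} :
    IsLeftSon π x y ↔ ∃ m : Fin n, (m : ℕ) + 1 = x ∧ SameBlock π y m ∧
      (∀ z, SameBlock π y z → z ≤ m) ∧ ∀ z, SameBlock π y z → y ≤ z := by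
  constructor
  · rintro ⟨b, hb, ⟨hy, hle⟩, m, ⟨hm, hge⟩, hx⟩
    exact ⟨m, hx, ⟨b, hb, hy, hm⟩, fun z hz => hge ((mem_iff_sameBlock hb hy).2 hz),
      fun z hz => hle ((mem_iff_sameBlock hb hy).2 hz)⟩
  · rintro ⟨m, hx, ⟨b, hb, hy, hm⟩, h1, h2⟩
    exact ⟨b, hb, ⟨hy, fun z hz => h2 z ((mem_iff_sameBlock hb hy).1 hz)⟩, m,
      ⟨hm, fun z hz => h1 z ((mem_iff_sameBlock hb hy).1 hz)⟩, hx⟩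

/-- The subtree with root described by `p` is the one on the labels `lo, …, hi - 1`. -/
structure Spans (π : Finpartition (Finset.univ : Finset (Fin n))) (lo hi : ℕ)
    (p : Fin n → Prop) : Prop where
  le : lo ≤ hi
  hi_le : hi ≤ n
  root : ∀ y : Fin n, p y ↔ lo ≤ y ∧ (y : ℕ) < hi ∧
    (∃ m : Fin n, (m : ℕ) + 1 = hi ∧ SameBlock π y m) ∧
    ∀ x : Fin n, lo ≤ x → SameBlock π y x → y ≤ x
  lt_hi : ∀ z y : Fin n, lo ≤ z → (z : ℕ) < hi → SameBlock π z y → (y : ℕ) < hi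
  last : ∀ z y m : Fin n, lo ≤ z → (z : ℕ) < hi → SameBlock π z y → (y : ℕ) < lo →
    (m : ℕ) + 1 = hi → SameBlock π z m
  prev : lo < hi → ∀ q : Fin n, (q : ℕ) + 1 = lo → ∃ y, q < y ∧ SameBlock π q y

theorem Spans.left (hπ : IsNoncrossing π) {lo hi : ℕ} {p : Fin n → Prop}
    (h : Spans π lo hi p) {x : Fin n} (hx : p x) : Spans π lo x (IsLeftSon π x) := by
  obtain ⟨hlo, hxhi, ⟨m, hm, hxm⟩, hmin⟩ := (h.root x).1 hx
  have key : ∀ z : Fin n, lo ≤ z → z < x → ¬ SameBlock π z m := by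
    intro z hz hzx hzm
    exact absurd (hmin z hz (hxm.trans hzm.symm)) (not_le.2 hzx)
  have hlt : ∀ z y : Fin n, lo ≤ z → (z : ℕ) < x → SameBlock π z y → (y : ℕ) < x := by
    intro z y hz hzx hzy
    have hyhi := h.lt_hi z y hz (by omega) hzy
    by_contra hcon
    have h1 : y ≠ x := by
      rintro rfl
      exact key z hz hzx (hzy.trans hxm)
    have h2 : y ≠ m := by
      rintro rfl
      exact key z hz hzx hzy
    have h1' : x < y := lt_of_le_of_ne (not_lt.1 hcon) h1.symm
    have h2' : y < m := lt_of_le_of_ne (Fin.le_def.2 (by omega)) h2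
    exact key z hz hzx ((hπ.sameBlock hzx h1' h2' hzy hxm).trans hxm)
  refine ⟨hlo, x.2.le, fun y => ?_, hlt, fun z y m' hz hzx hzy hy _ => ?_,
    fun hl => h.prev (by omega)⟩
  · rw [isLeftSon_iff]
    constructor
    · rintro ⟨m', hm', hym, hmax, hle⟩
      have hy : y ≤ m' := hle m' hym
      have hy' : (y : ℕ) ≤ m' := hy
      refine ⟨?_, by omega, ⟨m', hm', hym⟩, fun w _ hw => hle w hw⟩
      by_contra hcon
      by_cases hml : lo ≤ m'
      · exact key m' hml (Fin.lt_def.2 (by omega))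
          (h.last m' y m hml (by omega) hym.symm (by omega) hm)
      · obtain ⟨y', hy1, hy2⟩ := h.prev (by omega) m' (by omega)
        exact absurd (hmax y' (hym.trans hy2)) (not_le.2 hy1)
    · rintro ⟨hly, hyx, ⟨m', hm', hym⟩, hle⟩
      refine ⟨m', hm', hym, fun z hz => ?_, fun z hz => ?_⟩
      · have := hlt y z hly hyx hz
        exact Fin.le_def.2 (by omega)
      · by_cases hlz : lo ≤ z
        · exact hle z hlz hz
        · exact (key y hly hyx (h.last y z m hly (by omega) hz (by omega) hm)).elim
  · exact (key z hz hzx (h.last z y m hz (by omega) hzy hy hm)).elim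

theorem Spans.right (hπ : IsNoncrossing π) {lo hi : ℕ} {p : Fin n → Prop}
    (h : Spans π lo hi p) {x : Fin n} (hx : p x) :
    Spans π ((x : ℕ) + 1) hi (IsRightSon π x) := by
  obtain ⟨hlo, hxhi, ⟨m, hm, hxm⟩, hmin⟩ := (h.root x).1 hx
  refine ⟨hxhi, h.hi_le, fun y => ?_, fun z y hz => h.lt_hi z y (by omega),
    fun z y m' hz hzh hzy hy hm' => ?_, fun hl q hq => ?_⟩
  · rw [isRightSon_iff]
    constructor
    · rintro ⟨hxy, hlt, hle⟩
      exact ⟨hlt, h.lt_hi x y hlo hxhi hxy, ⟨m, hm, hxy.symm.trans hxm⟩,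
        fun w hw hyw => hle w (hxy.trans hyw) hw⟩
    · rintro ⟨hlt, -, ⟨m', hm', hym⟩, hle⟩
      obtain rfl : m' = m := Fin.ext (by omega)
      have hxy := hxm.trans hym.symm
      exact ⟨hxy, hlt, fun w hw hxw => hle w hxw (hxy.symm.trans hw)⟩
  · obtain rfl : m' = m := Fin.ext (by omega)
    by_cases hyx : y = x
    · subst hyx
      exact hzy.trans hxm
    have hyx' : y < x := lt_of_le_of_ne (Fin.le_def.2 (by omega)) hyx
    by_cases hyl : lo ≤ y
    · by_cases hzm : z = m'
      · subst hzm
        exact SameBlock.refl z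
      have hzm' : z < m' := lt_of_le_of_ne (Fin.le_def.2 (by omega)) hzm
      exact (hzy.trans (hπ.sameBlock hyx' hz hzm' hzy.symm hxm)).trans hxm
    · exact h.last z y m' (by omega) hzh hzy (by omega) hm
  · obtain rfl : q = x := Fin.ext (by omega)
    exact ⟨m, Fin.lt_def.2 (by omega), hxm⟩

theorem Spans.exists_root {lo hi : ℕ} {p : Fin n → Prop} (h : Spans π lo hi p) (hl : lo < hi) :
    ∃ y, p y := by
  have hhi := h.hi_le
  let m : Fin n := ⟨hi - 1, by omega⟩
  have hm : (m : ℕ) + 1 = hi := by simp only [m]; omega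
  obtain ⟨y, ⟨hy1, hy2⟩, hy3⟩ := wellFounded_lt.has_min
    {y : Fin n | lo ≤ y ∧ SameBlock π y m} ⟨m, by omega, SameBlock.refl m⟩
  exact ⟨y, (h.root y).2 ⟨hy1, h.lt_hi m y (by omega) (by omega) hy2.symm, ⟨m, hm, hy2⟩,
    fun x hx hyx => not_lt.1 (hy3 x ⟨hx, hyx.symm.trans hy2⟩)⟩⟩

theorem inorder_grow (hπ : IsNoncrossing π) : ∀ (k lo hi : ℕ) (p : Fin n → Prop),
    Spans π lo hi p → hi - lo ≤ k →
    (inorder (grow π k p)).map (fun i : Fin n => (i : ℕ)) = List.range' lo (hi - lo) := by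
  intro k
  induction k with
  | zero =>
    intro lo hi p h hk
    rw [Nat.le_zero.1 hk]
    rfl
  | succ k ih =>
    intro lo hi p h hk
    rw [grow]
    split_ifs with hp
    · obtain ⟨hlo, hxhi, -⟩ := (h.root _).1 hp.choose_spec
      have h1 := ih _ _ _ (h.left hπ hp.choose_spec) (by omega)
      have h2 := ih _ _ _ (h.right hπ hp.choose_spec) (by omega)
      rw [inorder, List.map_append, List.map_cons, h1, h2, ← List.range'_succ]
      have h3 : lo + 1 * ((hp.choose : ℕ) - lo) = hp.choose := by omega
      have h4 := @List.range'_append lo ((hp.choose : ℕ) - lo) (hi - (hp.choose + 1) + 1) 1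
      rw [h3] at h4
      rw [h4]
      congr 1
      omega
    · have hl : ¬ lo < hi := fun hl => hp (h.exists_root hl)
      rw [show hi - lo = 0 by omega]
      rfl

theorem spans_univ (π : Finpartition (Finset.univ : Finset (Fin n))) :
    Spans π 0 n (IsLeftSon π n) := by
  refine ⟨Nat.zero_le _, le_rfl, fun y => ?_, fun _ y _ _ _ => y.2,
    fun _ _ _ _ _ _ hy => absurd hy (Nat.not_lt_zero _), fun _ q hq => by omega⟩
  rw [isLeftSon_iff]
  constructor
  · rintro ⟨m, hm, hym, -, hle⟩
    exact ⟨Nat.zero_le _, y.2, ⟨m, hm, hym⟩, fun x _ => hle x⟩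
  · rintro ⟨-, -, ⟨m, hm, hym⟩, hle⟩
    exact ⟨m, hm, hym, fun z _ => Fin.le_def.2 (by omega), fun z => hle z (Nat.zero_le _)⟩

/-- The labels of the tree of a noncrossing partition, read in in-order, are
`0, 1, …, n - 1`: it is a binary search tree. -/
theorem inorder_labelledTree (hπ : IsNoncrossing π) :
    (inorder (labelledTree π)).map (fun i : Fin n => (i : ℕ)) = List.range n := by
  rw [labelledTree, inorder_grow hπ n 0 n _ (spans_univ π) (by omega), List.range_eq_range',
    Nat.sub_zero]

end

/-- The binary tree `T_π` of a noncrossing partition `π`. -/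
noncomputable def NC.tree {n : ℕ} (π : NC n) : Tam n :=
  ⟨(labelledTree π.1).map fun _ => (), by
    rw [numNodes_map, ← length_inorder]
    simpa using congrArg List.length (inorder_labelledTree π.2)⟩

end Tamari

/-! For a tree `T` and a vertex `a`, let `T.last a` be the largest label in the subtree rooted at
`a`. In `T_π` this is the maximum of the block of `a` (`NC.isGreatest_last_tree`), so the blocks of
`π` are the fibres of `last`. Conversely, the fibres of `last` on any tree form a noncrossing
partition, and a tree is determined by its last labels (`eq_of_reach_eq`), so every tree is some
`T_π` (`NC.tree_surjective`). Hence, for `S = T_{π₁}` and `T = T_{π₂}`, refinement `π₁ ≤ π₂` says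
that `S.last a = S.last b` implies `T.last a = T.last b`.

It remains to see that exceptionality of `[S, T]` is this same implication (`isExceptional_iff`).
Both halves of the interval-poset can be read off from `last`: for `j < i`, `i ⊲ j` means `i ≤
S.last j`; for `i < j`, `i ⊲ j` means that no `u` in `[i, j)` has `T.last u ≥ j`. A forbidden
configuration `y → x`, `y → z` yields `x` and `S.last x`, which agree under `S.last` but not under
`T.last`. Conversely, a closest pair `x < y` violating the implication gives a forbidden
configuration with `z = T.last y + 1`. -/

namespace Tamari

open BinaryTree

/-! ### The last label of a subtree -/

/-- The largest label in the subtree of `t` rooted at the vertex labelled `a`, when the vertices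
of `t` are labelled in in-order starting from `k`. -/
def reach : BinaryTree Unit → ℕ → ℕ → ℕ
  | nil, _, a => a
  | node _ l r, k, a =>
      if a < k + l.numNodes then reach l k a
      else if a = k + l.numNodes then k + l.numNodes + r.numNodes
      else reach r (k + l.numNodes + 1) a

theorem reach_of_lt {l : BinaryTree Unit} (r : BinaryTree Unit) (v : Unit) {k a : ℕ}
    (h : a < k + l.numNodes) : reach (node v l r) k a = reach l k a := by
  rw [reach, if_pos h]

theorem reach_root (l r : BinaryTree Unit) (v : Unit) (k : ℕ) :
    reach (node v l r) k (k + l.numNodes) = k + l.numNodes + r.numNodes := by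
  rw [reach, if_neg (lt_irrefl _), if_pos rfl]

theorem reach_of_gt {l : BinaryTree Unit} (r : BinaryTree Unit) (v : Unit) {k a : ℕ}
    (h : k + l.numNodes < a) : reach (node v l r) k a = reach r (k + l.numNodes + 1) a := by
  rw [reach, if_neg (by omega), if_neg (by omega)]

theorem le_reach (t : BinaryTree Unit) : ∀ k a : ℕ, a ≤ reach t k a := by
  induction t with
  | nil => intro k a; exact le_rfl
  | node v l r hl hr =>
    intro k a
    rw [reach]
    split_ifs
    · exact hl k a
    · omega
    · exact hr _ a

theorem reach_lt {t : BinaryTree Unit} : ∀ {k a : ℕ}, a < k + t.numNodes →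
    reach t k a < k + t.numNodes := by
  induction t with
  | nil => intro k a h; exact h
  | node v l r hl hr =>
    intro k a h
    simp only [numNodes] at h ⊢
    rw [reach]
    split_ifs with h1 h2
    · have := hl h1; omega
    · omega
    · have := hr (k := k + l.numNodes + 1) (a := a) (by omega); omega

/-- A subtree carries consecutive labels, so to the right of its root only its end matters. -/
theorem below_iff_le_reach {t : BinaryTree Unit} : ∀ {k a b : ℕ}, k ≤ a → a ≤ b →
    b < k + t.numNodes → (Below t k b a ↔ b ≤ reach t k a) := by
  induction t with
  | nil => intro k a b h1 h2 h3; simp only [numNodes] at h3; omega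
  | node v l r hl hr =>
    intro k a b h1 h2 h3
    simp only [numNodes] at h3
    rcases lt_trichotomy a (k + l.numNodes) with h | h | h
    · rw [reach_of_lt r v h]
      have hlt := reach_lt h
      constructor
      · rintro (h' | h' | h')
        · omega
        · exact (hl h1 h2 h'.bounds.2.1).1 h'
        · have := h'.bounds; omega
      · intro hb
        exact Or.inr (Or.inl ((hl h1 h2 (by omega)).2 hb))
    · subst h
      rw [reach_root]
      exact ⟨fun _ => by omega, fun _ => Or.inl ⟨rfl, by omega, by omega⟩⟩
    · rw [reach_of_gt r v h, ← hr (by omega) h2 (by omega)]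
      constructor
      · rintro (h' | h' | h')
        · omega
        · have := h'.bounds; omega
        · exact h'
      · exact fun h' => Or.inr (Or.inr h')

/-- If `a` is below `b`, every `u` in `[a, b)` lies in the left subtree of `b`. Otherwise the lowest
common ancestor of `a` and `b` lies in `[a, b)` and its subtree contains `b`. This expresses
increasing relations through last labels alone. -/
theorem below_iff_forall_reach_lt {t : BinaryTree Unit} : ∀ {k a b : ℕ}, k ≤ a → a < b →
    b < k + t.numNodes → (Below t k a b ↔ ∀ u, a ≤ u → u < b → reach t k u < b) := by
  induction t with
  | nil => intro k a b h1 h2 h3; simp only [numNodes] at h3; omega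
  | node v l r hl hr =>
    intro k a b h1 h2 h3
    simp only [numNodes] at h3
    rcases lt_trichotomy b (k + l.numNodes) with h | h | h
    · have hred : Below (node v l r) k a b ↔ Below l k a b := by
        refine ⟨?_, fun h' => Or.inr (Or.inl h')⟩
        rintro (h' | h' | h')
        · omega
        · exact h'
        · have := h'.bounds; omega
      rw [hred, hl h1 h2 h]
      refine forall₃_congr fun u _ hu => ?_
      rw [reach_of_lt r v (by omega)]
    · subst h
      refine ⟨fun _ u _ hu => ?_, fun _ => Or.inl ⟨rfl, by omega, by omega⟩⟩
      rw [reach_of_lt r v hu]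
      exact reach_lt hu
    · by_cases ha : k + l.numNodes < a
      · have hred : Below (node v l r) k a b ↔ Below r (k + l.numNodes + 1) a b := by
          refine ⟨?_, fun h' => Or.inr (Or.inr h')⟩
          rintro (h' | h' | h')
          · omega
          · have := h'.bounds; omega
          · exact h'
        rw [hred, hr (by omega) h2 (by omega)]
        refine forall₃_congr fun u hu _ => ?_
        rw [reach_of_gt r v (by omega)]
      · constructor
        · rintro (h' | h' | h')
          · omega
          · have := h'.bounds; omega
          · have := h'.bounds; omega
        · intro h'
          have := h' (k + l.numNodes) (by omega) h
          rw [reach_root] at this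
          omega

/-- A binary tree is determined by the last labels of its subtrees. -/
theorem eq_of_reach_eq {s : BinaryTree Unit} : ∀ {t : BinaryTree Unit} {k : ℕ},
    s.numNodes = t.numNodes →
    (∀ a, k ≤ a → a < k + s.numNodes → reach s k a = reach t k a) → s = t := by
  induction s with
  | nil =>
    intro t k h _
    cases t with
    | nil => rfl
    | node v l r => simp only [numNodes] at h; omega
  | node v l r hl hr =>
    intro t k h hreach
    cases t with
    | nil => simp only [numNodes] at h; omega
    | node v' l' r' =>
      simp only [numNodes] at h hreach
      -- If the roots differed, the smaller root label would reach the end of its own tree, while in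
      -- the other tree it lies in the left subtree and stops before the root.
      have hroot : l.numNodes = l'.numNodes := by
        rcases lt_trichotomy l.numNodes l'.numNodes with h' | h' | h'
        · have h1 := hreach (k + l.numNodes) (by omega) (by omega)
          have h2 := reach_lt (t := l') (k := k) (a := k + l.numNodes) (by omega)
          rw [reach_root, reach_of_lt r' v' (by omega)] at h1
          omega
        · exact h'
        · have h1 := hreach (k + l'.numNodes) (by omega) (by omega)
          have h2 := reach_lt (t := l) (k := k) (a := k + l'.numNodes) (by omega)
          rw [reach_root, reach_of_lt r v (by omega)] at h1
          omega
      have hleft : l = l' := hl (k := k) hroot fun a h1 h2 => by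
        have h3 := hreach a h1 (by omega)
        rwa [reach_of_lt r v h2, reach_of_lt r' v' (by omega)] at h3
      have hright : r = r' := hr (k := k + l.numNodes + 1) (by omega) fun a h1 h2 => by
        have h3 := hreach a (by omega) (by omega)
        rwa [reach_of_gt r v (by omega), reach_of_gt r' v' (by omega), ← hroot] at h3
      rw [hleft, hright]

/-! ### Last labels and the Tamari order -/

namespace Tam

variable {n : ℕ}

/-- The largest label in the subtree rooted at `a`. -/
def last (t : Tam n) (a : Fin n) : Fin n :=
  ⟨reach t.1 0 a, by
    have := reach_lt (t := t.1) (k := 0) (a := a) (by rw [t.2]; omega)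
    rwa [t.2, Nat.zero_add] at this⟩

theorem le_last (t : Tam n) (a : Fin n) : a ≤ t.last a :=
  le_reach t.1 0 a

theorem rel_iff_le_last (t : Tam n) {a b : Fin n} (h : a ≤ b) : t.rel b a ↔ b ≤ t.last a :=
  below_iff_le_reach (Nat.zero_le _) h (by rw [t.2]; omega)

theorem rel_iff_forall_last_lt (t : Tam n) {a b : Fin n} (h : a < b) :
    t.rel a b ↔ ∀ u, a ≤ u → u < b → t.last u < b := by
  refine (below_iff_forall_reach_lt (Nat.zero_le _) h (by rw [t.2]; omega)).trans ?_
  exact ⟨fun H u => H u, fun H u h1 h2 => H ⟨u, h2.trans b.2⟩ h1 h2⟩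

/-- The label intervals `[a, t.last a]` are nested or disjoint; this is what makes the fibres of
`last` noncrossing. -/
theorem last_le_last (t : Tam n) {a b : Fin n} (hab : a ≤ b) (hb : b ≤ t.last a) :
    t.last b ≤ t.last a :=
  (t.rel_iff_le_last (hab.trans (t.le_last b))).1
    (Below.trans ((t.rel_iff_le_last (t.le_last b)).2 le_rfl) ((t.rel_iff_le_last hab).2 hb))

theorem last_last (t : Tam n) (a : Fin n) : t.last (t.last a) = t.last a :=
  le_antisymm (t.last_le_last (t.le_last a) le_rfl) (t.le_last _)

/-- Going up in the Tamari order preserves decreasing relations, so a subtree can only extend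
further to the right of its root. -/
theorem last_mono {s t : Tam n} (h : s ≤ t) (a : Fin n) : s.last a ≤ t.last a := by
  rcases (s.le_last a).eq_or_lt with h' | h'
  · exact h' ▸ t.le_last a
  · exact (t.rel_iff_le_last (s.le_last a)).1
      (rel_dec_of_le h h' ((s.rel_iff_le_last (s.le_last a)).2 le_rfl))

theorem ext_last {s t : Tam n} (h : ∀ a, s.last a = t.last a) : s = t := by
  refine Subtype.ext (eq_of_reach_eq (k := 0) (s.2.trans t.2.symm) fun a _ ha => ?_)
  rw [s.2, Nat.zero_add] at ha
  exact congrArg Fin.val (h ⟨a, ha⟩)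

end Tam

/-! ### Interval-posets in terms of last labels -/

section

variable {n : ℕ} {S T : Tam n}

theorem intervalRel_of_gt {i j : Fin n} (h : j < i) : intervalRel S T i j ↔ i ≤ S.last j := by
  rw [← S.rel_iff_le_last h.le]
  refine ⟨?_, fun h' => Or.inr (Or.inl ⟨h, h'⟩)⟩
  rintro (rfl | h' | h')
  · exact (lt_irrefl _ h).elim
  · exact h'.2
  · exact (lt_asymm h h'.1).elim

theorem intervalRel_of_lt {i j : Fin n} (h : i < j) :
    intervalRel S T i j ↔ ∀ u, i ≤ u → u < j → T.last u < j := by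
  rw [← T.rel_iff_forall_last_lt h]
  refine ⟨?_, fun h' => Or.inr (Or.inr ⟨h, h'⟩)⟩
  rintro (rfl | h' | h')
  · exact (lt_irrefl _ h).elim
  · exact (lt_asymm h h'.1).elim
  · exact h'.2

theorem isExceptional_of_last_eq {I : NonemptyInterval (Tam n)}
    (H : ∀ a b, I.fst.last a = I.fst.last b → I.snd.last a = I.snd.last b) :
    (intervalPoset I).IsExceptional := by
  rintro ⟨x, y, z, hxy, hyz, ⟨hrz, -, hcz⟩, ⟨hrx, -, hcx⟩⟩
  have hS : y ≤ I.fst.last x := (intervalRel_of_gt hxy).1 hrx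
  have hT := (intervalRel_of_lt hyz).1 hrz
  have hST : I.fst.last x ≤ I.snd.last x := Tam.last_mono I.fst_le_snd x
  -- Otherwise `y ⊲ z ⊲ x`, against the arrow `y → x`.
  have h1 : I.fst.last x < z := by
    by_contra! hz
    rcases hcx z hrz ((intervalRel_of_gt (hxy.trans hyz)).2 hz) with h | h
    · exact hyz.ne h.symm
    · exact (hxy.trans hyz).ne h.symm
  -- Otherwise `y ⊲ x ⊲ z`, against the arrow `y → z`: the labels in `[x, y)` lie in the subtree of
  -- `x` in the upper tree, those in `[y, z)` are handled by `hT`.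
  have h2 : z ≤ I.snd.last x := by
    by_contra! hz
    refine (hcz x hrx ((intervalRel_of_lt (hxy.trans hyz)).2 fun u hu huz => ?_)).elim
      hxy.ne (hxy.trans hyz).ne
    rcases le_total y u with h | h
    · exact hT u h huz
    · exact (I.snd.last_le_last hu (h.trans (hS.trans hST))).trans_lt hz
  -- The vertex `I.fst.last x` lies in `[y, z)`, so its upper last label is less than `z`, whereas
  -- that of `x` is at least `z`.
  have h3 := H x (I.fst.last x) (I.fst.last_last x).symm
  exact absurd (hT _ hS h1) (not_lt.2 (h3 ▸ h2))

/-- Strong induction on the distance `d` makes a violating pair `x < y` a closest one, which is what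
rules out intermediate vertices in the two covering relations at `y`. -/
theorem last_eq_of_isExceptional {I : NonemptyInterval (Tam n)}
    (H : (intervalPoset I).IsExceptional) :
    ∀ d : ℕ, ∀ x y : Fin n, (y : ℕ) = x + d → I.fst.last x = I.fst.last y →
      I.snd.last x = I.snd.last y := by
  intro d
  induction d using Nat.strong_induction_on with
  | _ d ih =>
  intro x y hd hS
  rcases Nat.eq_zero_or_pos d with rfl | hd0
  · rw [Fin.ext (hd.trans (Nat.add_zero _))]
  by_contra hT
  have hxy : x < y := Fin.lt_def.2 (by omega)
  have hmono := Tam.last_mono I.fst_le_snd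
  -- Such a `w` would share the lower last label of `x` and `y`, and the two shorter pairs would
  -- give equality of the upper ones.
  have hcons : ∀ w, x < w → w < y → ¬ y ≤ I.fst.last w := by
    intro w h1 h2 h3
    have h1' := Fin.lt_def.1 h1
    have h2' := Fin.lt_def.1 h2
    have hw : I.fst.last w = I.fst.last x := by
      refine le_antisymm (I.fst.last_le_last h1.le ?_) ?_
      · exact h2.le.trans ((I.fst.le_last y).trans hS.ge)
      · exact hS ▸ I.fst.last_le_last h2.le h3
    exact hT ((ih (w - x) (by omega) x w (by omega) hw.symm).trans
      (ih (y - w) (by omega) w y (by omega) (hw.trans hS)))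
  have hyx : y ≤ I.fst.last x := (I.fst.le_last y).trans hS.ge
  have hlt : I.snd.last y < I.snd.last x :=
    lt_of_le_of_ne (I.snd.last_le_last hxy.le (hyx.trans (hmono x))) (Ne.symm hT)
  have hlt' := Fin.lt_def.1 hlt
  -- The first label past the upper subtree of `y`; it exists because that of `x` extends strictly
  -- further.
  obtain ⟨z, hz⟩ : ∃ z : Fin n, (z : ℕ) = I.snd.last y + 1 :=
    ⟨⟨I.snd.last y + 1, by omega⟩, rfl⟩
  have hzlt : ∀ u, u < z ↔ u ≤ I.snd.last y := fun u => by
    rw [Fin.lt_def, Fin.le_def]; omega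
  have hzle : ∀ u, z ≤ u ↔ I.snd.last y < u := fun u => by
    rw [Fin.lt_def, Fin.le_def]; omega
  have hyz : y < z := (hzlt y).2 (I.snd.le_last y)
  refine H ⟨x, y, z, hxy, hyz, ⟨?_, hyz.ne, fun w hyw hwz => ?_⟩,
    ⟨(intervalRel_of_gt hxy).2 hyx, hxy.ne', fun w hyw hwx => ?_⟩⟩
  · exact (intervalRel_of_lt hyz).2 fun u h1 h2 =>
      (hzlt _).2 (I.snd.last_le_last h1 ((hzlt _).1 h2))
  · rcases lt_trichotomy w y with h | h | h
    · have h1 := (intervalRel_of_gt h).1 hyw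
      have h2 := (intervalRel_of_lt (h.trans hyz)).1 hwz
      rcases lt_or_ge x w with h' | h'
      · exact (hcons w h' h h1).elim
      · exact absurd (h2 x h' (hxy.trans hyz)) (not_lt.2 ((hzle _).2 hlt))
    · exact Or.inl h
    · have h1 := (intervalRel_of_lt h).1 hyw
      rcases lt_trichotomy w z with h' | h' | h'
      · exact absurd (h1 y le_rfl h) (not_lt.2 ((hzlt _).1 h'))
      · exact Or.inr h'
      · have h2 := (intervalRel_of_gt h').1 hwz
        exact absurd (h1 z hyz.le h') (not_lt.2 (h2.trans (hmono z)))
  · rcases lt_trichotomy w y with h | h | h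
    · have h1 := (intervalRel_of_gt h).1 hyw
      rcases lt_trichotomy w x with h' | h' | h'
      · have h2 := (intervalRel_of_lt h').1 hwx w le_rfl h'
        exact absurd (h2.trans hxy) (not_lt.2 (h1.trans (hmono w)))
      · exact Or.inr h'
      · exact (hcons w h' h h1).elim
    · exact Or.inl h
    · have h1 := (intervalRel_of_lt h).1 hyw y le_rfl h
      have h2 := (intervalRel_of_gt (hxy.trans h)).1 hwx
      exact absurd (h1.trans_le (h2.trans hS.le)) (not_lt.2 (hmono y))

theorem isExceptional_iff {I : NonemptyInterval (Tam n)} : (intervalPoset I).IsExceptional ↔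
    ∀ a b, I.fst.last a = I.fst.last b → I.snd.last a = I.snd.last b := by
  refine ⟨fun H a b h => ?_, isExceptional_of_last_eq⟩
  rcases le_total a b with hab | hab
  · exact last_eq_of_isExceptional H (b - a) a b (by rw [Fin.le_def] at hab; omega) h
  · exact (last_eq_of_isExceptional H (a - b) b a (by rw [Fin.le_def] at hab; omega)
      h.symm).symm

end

/-! ### Noncrossing partitions -/

section

variable {n : ℕ} {π : Finpartition (Finset.univ : Finset (Fin n))}

theorem numNodes_grow (hπ : IsNoncrossing π) {k lo hi : ℕ} {p : Fin n → Prop}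
    (h : Spans π lo hi p) (hk : hi - lo ≤ k) : (grow π k p).numNodes = hi - lo := by
  rw [← length_inorder]
  simpa using congrArg List.length (inorder_grow hπ k lo hi p h hk)

/-- The root of a subtree on `lo, …, hi - 1` is in the block of `hi - 1`, and `Spans` keeps that
block below `hi`, so the end of the subtree is the block maximum. Other vertices are reached by
recursion. -/
theorem isGreatest_reach_grow (hπ : IsNoncrossing π) : ∀ (k lo hi : ℕ) (p : Fin n → Prop),
    Spans π lo hi p → hi - lo ≤ k → ∀ a m : Fin n, lo ≤ a → (a : ℕ) < hi →
      IsGreatest {b | SameBlock π a b} m →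
      reach ((grow π k p).map fun _ => ()) lo a = m := by
  intro k
  induction k with
  | zero => intro lo hi p h hk a m h1 h2; omega
  | succ k ih =>
    intro lo hi p h hk a m h1 h2 hm
    have hp := h.exists_root (h1.trans_lt h2)
    rw [grow, dif_pos hp]
    have hroot := hp.choose_spec
    generalize hp.choose = x at hroot
    obtain ⟨hlo, hxhi, ⟨m', hm', hxm'⟩, hmin⟩ := (h.root x).1 hroot
    have hL := h.left hπ hroot
    have hR := h.right hπ hroot
    have hnum : ((grow π k (IsLeftSon π x)).map fun _ => ()).numNodes = x - lo := by
      rw [numNodes_map, numNodes_grow hπ hL (by omega)]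
    have hnum' : ((grow π k (IsRightSon π x)).map fun _ => ()).numNodes = hi - (x + 1) := by
      rw [numNodes_map, numNodes_grow hπ hR (by omega)]
    rw [BinaryTree.map]
    rcases lt_trichotomy (a : ℕ) x with hax | hax | hax
    · rw [reach_of_lt _ _ (by omega)]
      exact ih _ _ _ hL (by omega) a m h1 hax hm
    · obtain rfl : a = x := Fin.ext hax
      have h3 := reach_root ((grow π k (IsLeftSon π a)).map fun _ => ())
        ((grow π k (IsRightSon π a)).map fun _ => ()) () lo
      rw [hnum, hnum', Nat.add_sub_cancel' hlo] at h3
      rw [h3]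
      have h4 := h.lt_hi a m hlo hxhi hm.1
      have h5 : m' ≤ m := hm.2 hxm'
      rw [Fin.le_def] at h5
      omega
    · rw [reach_of_gt _ _ (by omega), hnum, Nat.add_sub_cancel' hlo]
      exact ih _ _ _ hR (by omega) a m hax h2 hm

theorem NC.last_tree_eq {n : ℕ} (π : NC n) {a m : Fin n}
    (hm : IsGreatest {b | SameBlock π.1 a b} m) : π.tree.last a = m :=
  Fin.ext (isGreatest_reach_grow π.2 n 0 n _ (spans_univ π.1) (by omega) a m (Nat.zero_le _)
    a.2 hm)

theorem NC.isGreatest_last_tree {n : ℕ} (π : NC n) (a : Fin n) :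
    IsGreatest {b | SameBlock π.1 a b} (π.tree.last a) := by
  obtain ⟨m, hm⟩ := (Set.toFinite {b | SameBlock π.1 a b}).exists_maximal ⟨a, SameBlock.refl a⟩
  have hm' : IsGreatest {b | SameBlock π.1 a b} m :=
    ⟨hm.1, fun b hb => le_of_not_gt fun h => hm.not_gt hb h⟩
  rwa [π.last_tree_eq hm']

theorem NC.sameBlock_iff_last_tree_eq {n : ℕ} (π : NC n) {a b : Fin n} :
    SameBlock π.1 a b ↔ π.tree.last a = π.tree.last b := by
  constructor
  · intro h
    refine π.last_tree_eq ⟨h.trans (π.isGreatest_last_tree b).1, fun c hc => ?_⟩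
    exact (π.isGreatest_last_tree b).2 (h.symm.trans hc)
  · intro h
    have h1 := (π.isGreatest_last_tree a).1
    rw [h] at h1
    exact SameBlock.trans h1 (SameBlock.symm (π.isGreatest_last_tree b).1)

theorem NC.le_iff {n : ℕ} {π₁ π₂ : NC n} :
    π₁ ≤ π₂ ↔ ∀ a b, SameBlock π₁.1 a b → SameBlock π₂.1 a b := by
  constructor
  · rintro h a b ⟨c, hc, ha, hb⟩
    obtain ⟨d, hd, hcd⟩ := h hc
    exact ⟨d, hd, hcd ha, hcd hb⟩
  · intro h c hc
    obtain ⟨a, ha⟩ := π₁.1.nonempty_of_mem_parts hc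
    obtain ⟨d, hd, had⟩ := π₂.1.exists_mem (Finset.mem_univ a)
    exact ⟨d, hd, fun b hb => (mem_iff_sameBlock hd had).2 (h a b ⟨c, hc, ha, hb⟩)⟩

/-! ### From a tree back to a noncrossing partition -/

open Classical in
/-- The partition whose blocks are the sets of vertices with the same last label. -/
noncomputable def Tam.finpartition {n : ℕ} (t : Tam n) :
    Finpartition (Finset.univ : Finset (Fin n)) :=
  Finpartition.ofSetoid (Setoid.ker t.last)

theorem Tam.sameBlock_finpartition {n : ℕ} (t : Tam n) {a b : Fin n} :
    SameBlock t.finpartition a b ↔ t.last a = t.last b := by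
  classical
  have hpart := t.finpartition.part_mem.2 (Finset.mem_univ a)
  rw [← mem_iff_sameBlock hpart (t.finpartition.mem_part (Finset.mem_univ a))]
  exact Finpartition.mem_part_ofSetoid_iff_rel

/-- For crossing `i < j < k < l`, nesting gives `t.last j ≤ t.last i = t.last k ≤ t.last j`, which
merges the two blocks. -/
theorem Tam.isNoncrossing_finpartition {n : ℕ} (t : Tam n) : IsNoncrossing t.finpartition := by
  rintro ⟨b, hb, c, hc, hbc, i, j, k, l, hij, hjk, hkl, hi, hk, hj, hl⟩
  have h1 : t.last i = t.last k := t.sameBlock_finpartition.1 ⟨b, hb, hi, hk⟩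
  have h2 : t.last j = t.last l := t.sameBlock_finpartition.1 ⟨c, hc, hj, hl⟩
  have h3 : t.last j ≤ t.last i :=
    t.last_le_last hij.le (hjk.le.trans ((t.le_last k).trans h1.ge))
  have h4 : t.last k ≤ t.last j :=
    t.last_le_last hjk.le (hkl.le.trans ((t.le_last l).trans h2.ge))
  have h5 := t.sameBlock_finpartition.2 (le_antisymm (h1.le.trans h4) h3)
  exact hbc (t.finpartition.eq_of_mem_parts hb hc ((mem_iff_sameBlock hb hi).2 h5) hj)

/-- Every binary tree is the tree of a noncrossing partition. -/
theorem NC.tree_surjective (n : ℕ) : Function.Surjective (NC.tree : NC n → Tam n) := by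
  intro t
  refine ⟨⟨t.finpartition, t.isNoncrossing_finpartition⟩, Tam.ext_last fun a => ?_⟩
  refine NC.last_tree_eq _ ⟨t.sameBlock_finpartition.2 (t.last_last a).symm, fun b hb => ?_⟩
  exact (t.le_last b).trans (t.sameBlock_finpartition.1 hb).ge

end

end Tamari

theorem mainTheorem5 (n : ℕ) (I : NonemptyInterval (Tamari.Tam n)) :
    (∃ J : NonemptyInterval (Tamari.NC n),
      (I : Set (Tamari.Tam n)) = Set.Icc (Tamari.NC.tree J.fst) (Tamari.NC.tree J.snd)) ↔
    (Tamari.intervalPoset I).IsExceptional := by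
  rw [Tamari.isExceptional_iff]
  constructor
  · rintro ⟨J, hJ⟩ a b
    -- A nonempty interval, as a set, determines its endpoints.
    rw [NonemptyInterval.coe_def, Set.Icc_eq_Icc_iff I.fst_le_snd] at hJ
    rw [hJ.1, hJ.2, ← Tamari.NC.sameBlock_iff_last_tree_eq, ← Tamari.NC.sameBlock_iff_last_tree_eq]
    exact Tamari.NC.le_iff.1 J.fst_le_snd a b
  · intro H
    obtain ⟨π₁, h₁⟩ := Tamari.NC.tree_surjective n I.fst
    obtain ⟨π₂, h₂⟩ := Tamari.NC.tree_surjective n I.snd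
    refine ⟨⟨(π₁, π₂), Tamari.NC.le_iff.2 fun a b h => ?_⟩, ?_⟩
    · rw [Tamari.NC.sameBlock_iff_last_tree_eq, h₁] at h
      rw [Tamari.NC.sameBlock_iff_last_tree_eq, h₂]
      exact H a b h
    · rw [NonemptyInterval.coe_def]
      exact congrArg₂ Set.Icc h₁.symm h₂.symm
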